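/- **Lorentz covariance of the quasi-1D moment system.** Units are such that the speed of light and the particle rest mass equal $1$. Fix an order $M\ge 1$ and a relaxation time $\tau=\tau(n,\theta)>0$. *Notation.* For $\vec p=(p^1,p^2,p^3)\in\mathbb R^3$ let $p^0=\sqrt{1+|\vec p|^2}$; for $|u|<1$ let $U^0=(1-u^2)^{-1/2}$, $U^3=uU^0$, $E=U^0p^0-U^3p^3$, $y=(E^2-1)^{-1/2}(U^0p^3-U^3p^0)$; for $\theta>0$ let $\zeta=1/\theta$ and $$g_{[u,\theta]}(\vec p)=\frac{\zeta}{4\pi K_2(\zeta)}e^{-\zeta E},\qquad \langle f,h\rangle_{[u,\theta]}=\int_{\mathbb R^3}\frac{f\,h}{g_{[u,\theta]}}\,\frac{d^3\vec p}{p^0},$$ with $K_\nu$ the modified Bessel functions of the second kind and $G=K_3/K_2$. Let $P_k^{(\ell)}(\cdot;\zeta)$ be the orthonormal polynomials (degree $k$, positive leading coefficient $c_k^{(\ell)}$) for the weight $\frac{\zeta (x^2-1)^{\ell+1/2}}{(2\ell+1)K_2(\zeta)}e^{-\zeta x}$ on $[1,\infty)$, let $L_\ell$ be the Legendre polynomials,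 and let $\tilde P_k^{(\ell)}[u,\theta]=g_{[u,\theta]}\,P_k^{(\ell)}(E;\zeta)\,(E^2-1)^{\ell/2}L_\ell(y)$ for $k+\ell\le M$ ($N=(M+1)(M+2)/2$ functions). *Dependent variables.* $W=(n,u,\theta,\Pi,\tilde f,\dots)\in\mathbb R^{N}$, where $n,u,\theta,\Pi,\tilde f$ occupy the places $(k,\ell)=(0,0),(1,0),(0,1),(2,0),(1,1)$ (for $M=1$, $W=(n,u,\theta)$, and $\Pi=\tilde f=0$) and every other place holds a coefficient $f_k^{(\ell)}$. $W$ is admissible if $n>0$, $|u|<1$, $\theta>0$. Put $f_k^{(0)}=\delta_{k0}\,n/c_0^{(0)}-3P_k^{(0)}(0;\zeta)\,\Pi$ for $k\le 2$ and $f_k^{(1)}=P_k^{(1)}(0;\zeta)\,\tilde f$ for $k\le1$, and let $F_W=\sum_{k+\ell\le M} f_k^{(\ell)}\tilde P_k^{(\ell)}[u,\theta]$ be the projected distribution. $W$ is called the state of a distribution $f(\vec p)$, even in $p^1$ and in $p^2$ and with finite moments of the needed orders, if (integrals over $\mathbb R^3$ against $d^3\vec p/p^0$) $\int Ef=n$,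 $\int E^2f=n(G(\zeta)-\theta)$, $\int E(U^0p^3-U^3p^0)f=0$, if for $M\ge2$ also $\frac13\int(E^2-1)f=n\theta+\Pi$ and $\int(U^0p^3-U^3p^0)f=\tilde f$, and if the remaining entries are $f_k^{(\ell)}=\langle f,\tilde P_k^{(\ell)}\rangle_{[u,\theta]}$. *The system.* With the $N\times N$ matrices $$M^{\alpha}_{ij}=\langle p^\alpha\tilde P_i,\tilde P_j\rangle_{[u,\theta]}\ (\alpha=0,3),\qquad D_{ij}=\Big\langle \frac{\partial F_W}{\partial W_j},\tilde P_i\Big\rangle_{[u,\theta]},\qquad A_{ij}=\langle E\tilde P_i,\tilde P_j\rangle_{[u,\theta]},$$ $B^\alpha=M^\alpha D$, and $S(W)=-\frac1\tau A\,(\mathbf f-\mathbf f^{(0)})$, where $\mathbf f=(f_k^{(\ell)})$ and $\mathbf f^{(0)}=(n/c_0^{(0)},0,\dots,0)$, the quasi-1D moment system with Anderson–Witting source is $$B^0(W)\,\partial_tW+B^3(W)\,\partial_xW=S(W).$$ *Theorem.* This system is Lorentz covariant under the boosts $t'=\gamma(t-vx)$, $x'=\gamma(x-vt)$, $\gamma=(1-v^2)^{-1/2}$,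 $|v|<1$. Precisely, let $W'=(n,u',\theta,\Pi,\tilde f,\dots)$ with $u'=\frac{u-v}{1-uv}$ and all other entries unchanged. Then: 1. If an admissible $W$ is the state of $f$, then $W'$ is admissible and is the state of the transformed distribution $f'(\vec p\,')=f(\vec p)$, where $\vec p\,'=(p^1,p^2,\gamma(p^3-vp^0))$. 2. If a field $W(t,x)$ is differentiable at $(t,x)$ with an admissible value there, then $W'(t',x')$ is differentiable at the corresponding point, and $B^0(W')\partial_{t'}W'+B^3(W')\partial_{x'}W'=B^0(W)\partial_tW+B^3(W)\partial_xW$. 3. $S(W')=S(W)$ for all admissible $W$. 4. Consequently, for every open $\Omega\subset\mathbb R^2$ and every field $W$ with admissible values on $\Omega$, $W$ is a classical (differentiable, admissible) solution of the system on $\Omega$ if and only if $W'$ is one, in the variables $(t',x')$, on the boosted region $\Omega'$. -/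

import Mathlib

noncomputable section

namespace QuasiOneD

open MeasureTheory Polynomial

/-! Units: speed of light and particle rest mass are equal to one.
The inverse temperature is `ζ = θ⁻¹`. -/

/-- Modified Bessel function of the second kind. -/
def besselK (ν ζ : ℝ) : ℝ :=
  ∫ s in Set.Ioi (0 : ℝ), Real.cosh (ν * s) * Real.exp (-ζ * Real.cosh s)

/-- `G(ζ) = K₃(ζ) / K₂(ζ)`, the specific enthalpy. -/
def enthalpy (ζ : ℝ) : ℝ := besselK 3 ζ / besselK 2 ζ

/-! ### The orthonormal polynomials `P_k^{(ℓ)}(x; ζ)` -/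

/-- The weight `ω^{(ℓ)}(x; ζ)` on `[1, ∞)`. -/
def weight (l : ℕ) (ζ x : ℝ) : ℝ :=
  ζ * (x ^ 2 - 1) ^ ((l : ℝ) + 1 / 2) / ((2 * (l : ℝ) + 1) * besselK 2 ζ) * Real.exp (-ζ * x)

/-- The inner product with respect to `ω^{(ℓ)}` of two polynomials. -/
def weightInner (l : ℕ) (ζ : ℝ) (P Q : ℝ[X]) : ℝ :=
  ∫ x in Set.Ioi (1 : ℝ), P.eval x * Q.eval x * weight l ζ x

/-- `P_k^{(ℓ)}(·; ζ)`: the orthonormal polynomial of degree `k` with positive leading coefficient,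
produced by the Gram-Schmidt process from `1, x, x², …`. -/
def orthoPoly (l : ℕ) (ζ : ℝ) (k : ℕ) : ℝ[X] :=
  let Q : ℝ[X] := X ^ k -
    ∑ j : Fin k, C (weightInner l ζ (X ^ k) (orthoPoly l ζ j)) * orthoPoly l ζ j
  C (Real.sqrt (weightInner l ζ Q Q))⁻¹ * Q
termination_by k
decreasing_by exact j.2

/-- The Legendre polynomial (Rodrigues formula); it is the spherical harmonic `Y_{ℓ,0}`. -/
def legendre (l : ℕ) : ℝ[X] :=
  C (((2 : ℝ) ^ l * (l.factorial : ℝ))⁻¹) * derivative^[l] ((X ^ 2 - 1) ^ l)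

/-! ### Momentum space and kinematics -/

/-- Spatial momenta `(p¹, p², p³)`; the coordinate `p³` along the `x`-axis is `p 2`. -/
abbrev Momentum := Fin 3 → ℝ

/-- `p⁰`, from the mass-shell condition. -/
def p0 (p : Momentum) : ℝ := Real.sqrt (1 + p 0 ^ 2 + p 1 ^ 2 + p 2 ^ 2)

/-- The Lorentz factor. -/
def gammaFactor (u : ℝ) : ℝ := (Real.sqrt (1 - u ^ 2))⁻¹

/-- `E = U_α p^α` with `(U^α) = γ(u) (1, 0, 0, u)`. -/
def energy (u : ℝ) (p : Momentum) : ℝ := gammaFactor u * p0 p - gammaFactor u * u * p 2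

/-- `- n_{3,α} p^α = U⁰ p³ - U³ p⁰` with `(n_3^α) = (U³, 0, 0, U⁰)`. -/
def axialMomentum (u : ℝ) (p : Momentum) : ℝ := gammaFactor u * p 2 - gammaFactor u * u * p0 p

/-- `y = (E² - 1)^{-1/2} (U⁰ p³ - U³ p⁰)`. -/
def cosAngle (u : ℝ) (p : Momentum) : ℝ :=
  axialMomentum u p / Real.sqrt (energy u p ^ 2 - 1)

/-- The weight function `g⁽⁰⁾_{[u,θ]}` (normalized Maxwell-Jüttner distribution). -/
def juttner (u θ : ℝ) (p : Momentum) : ℝ :=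
  θ⁻¹ / (4 * Real.pi * besselK 2 θ⁻¹) * Real.exp (-energy u p / θ)

/-- The inner product `⟨f, h⟩` of the weighted polynomial space belonging to `g⁽⁰⁾_{[u,θ]}`. -/
def momInner (u θ : ℝ) (f h : Momentum → ℝ) : ℝ :=
  ∫ p : Momentum, (juttner u θ p)⁻¹ * f p * h p * (p0 p)⁻¹

/-! ### The basis of the quasi-1D weighted polynomial space of order `M` -/

/-- Pairs `(ℓ, k)` with `ℓ ≤ M` and `k ≤ M - ℓ`; there are `(M+1)(M+2)/2` of them. -/
abbrev Idx (M : ℕ) := (l : Fin (M + 1)) × Fin (M + 1 - (l : ℕ))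

/-- `P̃_{k,0}^{(ℓ)}[u,θ] = g⁽⁰⁾ P_k^{(ℓ)}(E; θ⁻¹) (E² - 1)^{ℓ/2} Y_{ℓ,0}(y)`. -/
def basisFun (l k : ℕ) (u θ : ℝ) (p : Momentum) : ℝ :=
  juttner u θ p * (orthoPoly l θ⁻¹ k).eval (energy u p) *
    (Real.sqrt (energy u p ^ 2 - 1) ^ l * (legendre l).eval (cosAngle u p))

/-! ### The dependent variables -/

/-- A vector `W = (n, u, θ, Π, f̃_{0}^{(1)}, f_{0}^{(2)}, f_{3}^{(0)}, …)`. The places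
of the basis functions `(k,ℓ) = (0,0), (1,0), (0,1), (2,0), (1,1)` are taken
by `n, u, θ, Π, f̃_0^{(1)}`; every other place `(k,ℓ)` holds the coefficient `f_{k,0}^{(ℓ)}`. -/
abbrev State (M : ℕ) := Idx M → ℝ

/-- The entry of `W` at the place `(k, ℓ)`; zero if there is no such place. -/
def State.entry {M : ℕ} (W : State M) (k l : ℕ) : ℝ :=
  if h : l < M + 1 ∧ k < M + 1 - l then W ⟨⟨l, h.1⟩, ⟨k, h.2⟩⟩ else 0

/-- Number density `n`. -/
def State.density {M : ℕ} (W : State M) : ℝ := W.entry 0 0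
/-- Velocity `u = u³`. -/
def State.velocity {M : ℕ} (W : State M) : ℝ := W.entry 1 0
/-- Temperature `θ`. -/
def State.temp {M : ℕ} (W : State M) : ℝ := W.entry 0 1
/-- Bulk viscous pressure `Π` (absent, hence zero, if `M = 1`). -/
def State.bulk {M : ℕ} (W : State M) : ℝ := W.entry 2 0
/-- Particle diffusion `f̃_{0,0}^{(1)}` (absent, hence zero, if `M = 1`). -/
def State.diffusion {M : ℕ} (W : State M) : ℝ := W.entry 1 1

/-- The physically admissible states. -/
def State.Admissible {M : ℕ} (W : State M) : Prop :=
  0 < W.density ∧ |W.velocity| < 1 ∧ 0 < W.temp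

/-- The coefficients of `f⁽⁰⁾ = n g⁽⁰⁾`, namely `(n / c_0^{(0)}, 0, …, 0)`, where `c_0^{(0)}` is the
leading coefficient of `P_0^{(0)}`. -/
def equilibriumCoeff {M : ℕ} (W : State M) (q : Idx M) : ℝ :=
  if (q.1 : ℕ) = 0 ∧ (q.2 : ℕ) = 0 then
    W.density / (orthoPoly 0 W.temp⁻¹ 0).leadingCoeff else 0

/-- The vector `f_M = D_M^W W_M` of all coefficients `f_{k,0}^{(ℓ)}`. The five coefficients whose
places are taken by `n, u, θ, Π, f̃_0^{(1)}` follow from the moment conditions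
`∫ f = n (G - 4θ) - 3Π`, `∫ E f = n`, `∫ E² f = n (G - θ)`,
`∫ (U⁰p³ - U³p⁰) f = f̃_0^{(1)}`, `∫ E (U⁰p³ - U³p⁰) f = 0` (integrals against `d³p / p⁰`). -/
def coeff {M : ℕ} (W : State M) (q : Idx M) : ℝ :=
  if (q.1 : ℕ) = 0 ∧ (q.2 : ℕ) ≤ 2 then
    equilibriumCoeff W q - 3 * (orthoPoly 0 W.temp⁻¹ q.2).eval 0 * W.bulk
  else if (q.1 : ℕ) = 1 ∧ (q.2 : ℕ) ≤ 1 then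
    (orthoPoly 1 W.temp⁻¹ q.2).eval 0 * W.diffusion
  else W q

/-- The projected distribution `Π_M[u,θ] f`, a function of `W` and `p`. -/
def projDist {M : ℕ} (W : State M) (p : Momentum) : ℝ :=
  ∑ q : Idx M, coeff W q * basisFun q.1 q.2 W.velocity W.temp p

/-! ### The quasi-1D moment system -/

/-- The matrix `⟨a P̃_i, P̃_j⟩` of "multiply by `a` and project". -/
def multMatrix {M : ℕ} (a : Momentum → ℝ) (W : State M) : Matrix (Idx M) (Idx M) ℝ :=
  Matrix.of fun i j => momInner W.velocity W.temp
    (fun p => a p * basisFun i.1 i.2 W.velocity W.temp p)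
    (basisFun j.1 j.2 W.velocity W.temp)

/-- `M^0`: multiplication by `p⁰`. -/
def M0 {M : ℕ} (W : State M) : Matrix (Idx M) (Idx M) ℝ := multMatrix p0 W
/-- `M^3`: multiplication by `p³`. -/
def M3 {M : ℕ} (W : State M) : Matrix (Idx M) (Idx M) ℝ := multMatrix (fun p => p 2) W

/-- The matrix `D_M`, determined by `Π_M ∂_s (Π_M f) = [P_M, D_M ∂_s W_M]`: its column `j` consists
of the coefficients of the projection of `∂ (Π_M f) / ∂ W_j`. -/
def Dmat {M : ℕ} (W : State M) : Matrix (Idx M) (Idx M) ℝ :=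
  Matrix.of fun i j => momInner W.velocity W.temp
    (fun p => deriv (fun s => projDist (Function.update W j s) p) (W j))
    (basisFun i.1 i.2 W.velocity W.temp)

/-- `B^0 = M^0 D`. -/
def B0 {M : ℕ} (W : State M) : Matrix (Idx M) (Idx M) ℝ := M0 W * Dmat W
/-- `B^3 = M^3 D`. -/
def B3 {M : ℕ} (W : State M) : Matrix (Idx M) (Idx M) ℝ := M3 W * Dmat W

/-- The Anderson-Witting source term; the relaxation time `τ` may depend on `n` and `θ`. -/
def source {M : ℕ} (τ : ℝ → ℝ → ℝ) (W : State M) : State M :=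
  -((τ W.density W.temp)⁻¹ •
    (multMatrix (energy W.velocity) W).mulVec (fun q => coeff W q - equilibriumCoeff W q))

/-- `B^0 ∂_t W + B^3 ∂_x W` at the point `z = (t, x)`. -/
def transport {M : ℕ} (W : ℝ × ℝ → State M) (z : ℝ × ℝ) : State M :=
  (B0 (W z)).mulVec (fderiv ℝ W z (1, 0)) + (B3 (W z)).mulVec (fderiv ℝ W z (0, 1))

/-- `W` is a classical, physically admissible solution of the quasi-1D moment system with
Anderson-Witting source term on the space-time region `Ω`. -/
def IsSolution {M : ℕ} (τ : ℝ → ℝ → ℝ) (Ω : Set (ℝ × ℝ)) (W : ℝ × ℝ → State M) : Prop :=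
  ∀ z ∈ Ω, (W z).Admissible ∧ DifferentiableAt ℝ W z ∧ transport W z = source τ (W z)

/-! ### Lorentz boosts in the `x`-direction -/

/-- `t' = γ(v)(t - v x)`, `x' = γ(v)(x - v t)`. -/
def boostPoint (v : ℝ) (z : ℝ × ℝ) : ℝ × ℝ :=
  (gammaFactor v * (z.1 - v * z.2), gammaFactor v * (z.2 - v * z.1))

/-- The boost of the momentum: `p¹, p²` are unchanged and `(p³)' = γ(v)(p³ - v p⁰)`. -/
def boostMomentum (v : ℝ) (p : Momentum) : Momentum :=
  ![p 0, p 1, gammaFactor v * (p 2 - v * p0 p)]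

/-- The dependent variables seen from the boosted frame: the velocity becomes
`(u - v)/(1 - u v)`, everything else is a scalar. -/
def boostState {M : ℕ} (v : ℝ) (W : State M) : State M := fun q =>
  if (q.1 : ℕ) = 0 ∧ (q.2 : ℕ) = 1 then (W.velocity - v) / (1 - W.velocity * v) else W q

/-- The field `W'(t', x')` that an observer in the boosted frame assigns to `W(t, x)`. -/
def boostField {M : ℕ} (v : ℝ) (W : ℝ × ℝ → State M) (z' : ℝ × ℝ) : State M :=
  boostState v (W (boostPoint (-v) z'))

/-- `W` is the vector of dependent variables of the distribution `f`, which is symmetric in `p¹` and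
in `p²`: the velocity `u` is the Landau-Lifshitz velocity, `n` and `θ` are given by the matching
conditions, `Π` and `f̃_0^{(1)}` are the bulk viscous pressure and the diffusion, and all remaining
entries are the coefficients `f_{k,0}^{(ℓ)} = ⟨f, P̃_{k,0}^{(ℓ)}⟩`. -/
structure IsStateOf {M : ℕ} (f : Momentum → ℝ) (W : State M) : Prop where
  symm_one : ∀ p, f (Function.update p 0 (-p 0)) = f p
  symm_two : ∀ p, f (Function.update p 1 (-p 1)) = f p
  integrable : ∀ N ≤ max M 2, Integrable (fun p : Momentum => p0 p ^ N * f p * (p0 p)⁻¹)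
  density : ∫ p, energy W.velocity p * f p * (p0 p)⁻¹ = W.density
  landau : ∫ p, energy W.velocity p * axialMomentum W.velocity p * f p * (p0 p)⁻¹ = 0
  energy : ∫ p, energy W.velocity p ^ 2 * f p * (p0 p)⁻¹ =
    W.density * (enthalpy W.temp⁻¹ - W.temp)
  bulk : 2 ≤ M → (1 / 3) * ∫ p, (QuasiOneD.energy W.velocity p ^ 2 - 1) * f p * (p0 p)⁻¹ =
    W.density * W.temp + W.bulk
  diffusion : 2 ≤ M → ∫ p, axialMomentum W.velocity p * f p * (p0 p)⁻¹ = W.diffusion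
  coeff : ∀ q : Idx M, ¬ ((q.1 : ℕ) = 0 ∧ (q.2 : ℕ) ≤ 2) → ¬ ((q.1 : ℕ) = 1 ∧ (q.2 : ℕ) ≤ 1) →
    W q = momInner W.velocity W.temp f (basisFun q.1 q.2 W.velocity W.temp)

end QuasiOneD

end

namespace QuasiOneD

open MeasureTheory Polynomial

/-! A boost acts on momentum space by a bijection preserving `d³p / p⁰`. If the velocity is
transformed along with the momentum, then `E` and the axial momentum are unchanged, being Lorentz
contractions. Hence the Jüttner weight, every basis function, the inner product and `projDist` are
scalars (`basisFun_boostMomentum`, `momInner_boostMomentum`, `projDist_boostState`), and so is the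
source, whose matrix multiplies by `E`.

The matrices `M0` and `M3` mix like `p⁰` and `p³`, since multiplication by `a` becomes
multiplication by `a` composed with the boost. The matrix `Dmat` is contragredient to the change of
variables: `D(W') J = D(W)`, where `J` is the diagonal Jacobian of `boostState`
(`Dmat_boostState_mul`). Derivatives of `W'` are `J` applied to boosted derivatives of `W`, so `J`
cancels and the left-hand side becomes `γ² ((M⁰ - v M³) D (∂_t + v ∂_x) + (M³ - v M⁰) D (∂_x + v
∂_t)) W`, which collapses because `γ² (1 - v²) = 1` (`transport_boostField`).

Neither orthonormality of the basis nor differentiability of `projDist` enters. Convergence of the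
matrix integrals is needed only to split `p⁰ - v p³` and `p³ - v p⁰` in `multMatrix_linear`. -/

/-! ### Velocity subtraction and Lorentz factors -/

/-- Relativistic velocity subtraction. -/
noncomputable def relVelocity (v u : ℝ) : ℝ := (u - v) / (1 - u * v)

lemma one_sub_sq_pos {v : ℝ} (hv : |v| < 1) : 0 < 1 - v ^ 2 := by
  have := abs_lt.1 hv
  nlinarith

lemma gammaFactor_pos {v : ℝ} (hv : |v| < 1) : 0 < gammaFactor v :=
  inv_pos.2 (Real.sqrt_pos.2 (one_sub_sq_pos hv))

/-- Together with the mass-shell relation `p0_sq`, this is the only input to the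
`linear_combination` steps below. -/
lemma gammaFactor_sq_mul {v : ℝ} (hv : |v| < 1) : gammaFactor v ^ 2 * (1 - v ^ 2) = 1 := by
  have h := one_sub_sq_pos hv
  rw [gammaFactor, inv_pow, Real.sq_sqrt h.le, inv_mul_cancel₀ h.ne']

lemma gammaFactor_neg (v : ℝ) : gammaFactor (-v) = gammaFactor v := by
  simp [gammaFactor]

lemma one_sub_mul_pos {u v : ℝ} (hu : |u| < 1) (hv : |v| < 1) : 0 < 1 - u * v := by
  have : |u * v| < 1 := by
    rw [abs_mul]
    exact mul_lt_one_of_nonneg_of_lt_one_left (abs_nonneg _) hu hv.le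
  linarith [(abs_lt.1 this).2]

/-- Rests on `(1 - uv)² - (u - v)² = (1 - u²)(1 - v²)`; it yields both subluminality and the
composition law of Lorentz factors. -/
lemma one_sub_relVelocity_sq {u v : ℝ} (hu : |u| < 1) (hv : |v| < 1) :
    1 - relVelocity v u ^ 2 = (1 - u ^ 2) * (1 - v ^ 2) / (1 - u * v) ^ 2 := by
  have h := (one_sub_mul_pos hu hv).ne'
  rw [relVelocity]
  field_simp
  ring

lemma abs_relVelocity_lt_one {u v : ℝ} (hu : |u| < 1) (hv : |v| < 1) :
    |relVelocity v u| < 1 := by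
  have h : 0 < 1 - relVelocity v u ^ 2 := by
    rw [one_sub_relVelocity_sq hu hv]
    have := one_sub_sq_pos hu
    have := one_sub_sq_pos hv
    have := one_sub_mul_pos hu hv
    positivity
  exact (sq_lt_one_iff_abs_lt_one _).1 (by linarith)

lemma relVelocity_neg_relVelocity {u v : ℝ} (hu : |u| < 1) (hv : |v| < 1) :
    relVelocity (-v) (relVelocity v u) = u := by
  have h := (one_sub_mul_pos hu hv).ne'
  have h' := (one_sub_sq_pos hv).ne'
  have e : 1 - (u - v) / (1 - u * v) * -v = (1 - v ^ 2) / (1 - u * v) := by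
    field_simp
    ring
  rw [relVelocity, relVelocity, e]
  field_simp
  ring

lemma hasDerivAt_relVelocity {u v : ℝ} (hu : |u| < 1) (hv : |v| < 1) :
    HasDerivAt (relVelocity v) ((1 - v ^ 2) / (1 - u * v) ^ 2) u := by
  have h := (one_sub_mul_pos hu hv).ne'
  have h1 : HasDerivAt (fun u : ℝ => u - v) 1 u := (hasDerivAt_id u).sub_const v
  have h2 : HasDerivAt (fun u : ℝ => 1 - u * v) (-(1 * v)) u :=
    ((hasDerivAt_id u).mul_const v).const_sub 1
  refine (h1.div h2 h).congr_deriv ?_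
  congr 1
  ring

lemma gammaFactor_relVelocity {u v : ℝ} (hu : |u| < 1) (hv : |v| < 1) :
    gammaFactor (relVelocity v u) = gammaFactor u * gammaFactor v * (1 - u * v) := by
  rw [gammaFactor, one_sub_relVelocity_sq hu hv, Real.sqrt_div' _ (sq_nonneg _),
    Real.sqrt_sq (one_sub_mul_pos hu hv).le, Real.sqrt_mul (one_sub_sq_pos hu).le, inv_div,
    gammaFactor, gammaFactor, div_eq_mul_inv, mul_inv]
  ring

lemma gammaFactor_relVelocity_mul {u v : ℝ} (hu : |u| < 1) (hv : |v| < 1) :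
    gammaFactor (relVelocity v u) * relVelocity v u =
      gammaFactor u * gammaFactor v * (u - v) := by
  rw [gammaFactor_relVelocity hu hv, relVelocity]
  field_simp [(one_sub_mul_pos hu hv).ne']

/-! ### Boosts of momenta -/

lemma one_le_p0 (p : Momentum) : 1 ≤ p0 p := by
  rw [p0, Real.one_le_sqrt]
  nlinarith [sq_nonneg (p 0), sq_nonneg (p 1), sq_nonneg (p 2)]

lemma p0_pos (p : Momentum) : 0 < p0 p := one_pos.trans_le (one_le_p0 p)

lemma p0_sq (p : Momentum) : p0 p ^ 2 = 1 + p 0 ^ 2 + p 1 ^ 2 + p 2 ^ 2 :=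
  Real.sq_sqrt (by positivity)

lemma abs_coord_le_p0 (p : Momentum) (i : Fin 3) : |p i| ≤ p0 p := by
  refine abs_le_of_sq_le_sq ?_ (p0_pos p).le
  rw [p0_sq]
  fin_cases i <;> simp only [Fin.zero_eta, Fin.mk_one, Fin.reduceFinMk] <;>
    nlinarith [sq_nonneg (p 0), sq_nonneg (p 1), sq_nonneg (p 2)]

lemma mul_coord_lt_p0 {v : ℝ} (hv : |v| < 1) (p : Momentum) : v * p 2 < p0 p := by
  refine (le_abs_self _).trans_lt ?_
  rw [abs_mul]
  nlinarith [abs_coord_le_p0 p 2, p0_pos p, abs_nonneg v]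

@[simp] lemma boostMomentum_zero (v : ℝ) (p : Momentum) : boostMomentum v p 0 = p 0 := rfl
@[simp] lemma boostMomentum_one (v : ℝ) (p : Momentum) : boostMomentum v p 1 = p 1 := rfl
@[simp] lemma boostMomentum_two (v : ℝ) (p : Momentum) :
    boostMomentum v p 2 = gammaFactor v * (p 2 - v * p0 p) := rfl

/-- The boost preserves `(p⁰)² - (p³)²`, so the squares agree by the mass-shell condition;
positivity of both sides fixes the sign. -/
lemma p0_boostMomentum {v : ℝ} (hv : |v| < 1) (p : Momentum) :
    p0 (boostMomentum v p) = gammaFactor v * (p0 p - v * p 2) := by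
  have h : 0 < gammaFactor v * (p0 p - v * p 2) :=
    mul_pos (gammaFactor_pos hv) (sub_pos.2 (mul_coord_lt_p0 hv p))
  rw [← sq_eq_sq₀ (p0_pos _).le h.le, p0_sq]
  simp only [boostMomentum_zero, boostMomentum_one, boostMomentum_two]
  linear_combination (p 2 ^ 2 - p0 p ^ 2) * gammaFactor_sq_mul hv - p0_sq p

lemma boostMomentum_neg_boostMomentum {v : ℝ} (hv : |v| < 1) (p : Momentum) :
    boostMomentum (-v) (boostMomentum v p) = p := by
  ext i
  fin_cases i
  · rfl
  · rfl
  · simp only [Fin.reduceFinMk, boostMomentum_two, gammaFactor_neg, p0_boostMomentum hv]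
    linear_combination p 2 * gammaFactor_sq_mul hv

lemma boostMomentum_boostMomentum_neg {v : ℝ} (hv : |v| < 1) (p : Momentum) :
    boostMomentum v (boostMomentum (-v) p) = p := by
  simpa using boostMomentum_neg_boostMomentum (v := -v) (by rwa [abs_neg]) p

/-- Four-velocity and four-momentum undergo the same boost, which preserves their Minkowski product.
The next lemma is the same argument for the axial vector `n_3`. -/
lemma energy_boostMomentum {u v : ℝ} (hu : |u| < 1) (hv : |v| < 1) (p : Momentum) :
    energy (relVelocity v u) (boostMomentum v p) = energy u p := by
  rw [energy, gammaFactor_relVelocity_mul hu hv, gammaFactor_relVelocity hu hv,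
    p0_boostMomentum hv, boostMomentum_two, energy]
  linear_combination (gammaFactor u * p0 p - gammaFactor u * u * p 2) * gammaFactor_sq_mul hv

lemma axialMomentum_boostMomentum {u v : ℝ} (hu : |u| < 1) (hv : |v| < 1) (p : Momentum) :
    axialMomentum (relVelocity v u) (boostMomentum v p) = axialMomentum u p := by
  rw [axialMomentum, gammaFactor_relVelocity_mul hu hv, gammaFactor_relVelocity hu hv,
    p0_boostMomentum hv, boostMomentum_two, axialMomentum]
  linear_combination (gammaFactor u * p 2 - gammaFactor u * u * p0 p) * gammaFactor_sq_mul hv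

lemma juttner_boostMomentum {u v : ℝ} (hu : |u| < 1) (hv : |v| < 1) (θ : ℝ) (p : Momentum) :
    juttner (relVelocity v u) θ (boostMomentum v p) = juttner u θ p := by
  rw [juttner, energy_boostMomentum hu hv, juttner]

lemma basisFun_boostMomentum {u v : ℝ} (hu : |u| < 1) (hv : |v| < 1) (l k : ℕ) (θ : ℝ)
    (p : Momentum) :
    basisFun l k (relVelocity v u) θ (boostMomentum v p) = basisFun l k u θ p := by
  simp only [basisFun, cosAngle, juttner_boostMomentum hu hv, energy_boostMomentum hu hv,
    axialMomentum_boostMomentum hu hv]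

/-! ### Lorentz invariance of the measure `d³p / p⁰` -/

/-- The Jacobian matrix of `boostMomentum v`. -/
noncomputable def boostJacobian (v : ℝ) (p : Momentum) : Matrix (Fin 3) (Fin 3) ℝ :=
  !![1, 0, 0; 0, 1, 0;
    -(gammaFactor v * v * (p 0 / p0 p)), -(gammaFactor v * v * (p 1 / p0 p)),
    gammaFactor v * (1 - v * (p 2 / p0 p))]

/-- The derivative of `boostMomentum v`. -/
noncomputable def boostDeriv (v : ℝ) (p : Momentum) : Momentum →L[ℝ] Momentum :=
  LinearMap.toContinuousLinearMap (Matrix.toLin' (boostJacobian v p))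

lemma hasFDerivAt_p0 (p : Momentum) :
    HasFDerivAt p0 (∑ i : Fin 3, (p i / p0 p) • ContinuousLinearMap.proj (R := ℝ)
      (φ := fun _ : Fin 3 => ℝ) i) p := by
  have hc (i : Fin 3) : HasFDerivAt (fun p : Momentum => p i)
      (ContinuousLinearMap.proj (R := ℝ) (φ := fun _ : Fin 3 => ℝ) i) p :=
    hasFDerivAt_apply i p
  have hpos : 1 + p 0 ^ 2 + p 1 ^ 2 + p 2 ^ 2 ≠ 0 := by positivity
  have h := (((((hc 0).pow 2).const_add 1).add ((hc 1).pow 2)).add ((hc 2).pow 2)).sqrt hpos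
  refine h.congr_fderiv ?_
  ext x
  have := (p0_pos p).ne'
  simp only [Fin.sum_univ_three, p0]
  simp
  field_simp

lemma hasFDerivAt_boostMomentum (v : ℝ) (p : Momentum) :
    HasFDerivAt (boostMomentum v) (boostDeriv v p) p := by
  have hc (i : Fin 3) : HasFDerivAt (fun p : Momentum => p i)
      (ContinuousLinearMap.proj (R := ℝ) (φ := fun _ : Fin 3 => ℝ) i) p :=
    hasFDerivAt_apply i p
  rw [hasFDerivAt_pi']
  intro i
  fin_cases i
  · refine (hc 0).congr_fderiv ?_
    ext x
    simp [boostDeriv, boostJacobian, dotProduct, Fin.sum_univ_three]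
  · refine (hc 1).congr_fderiv ?_
    ext x
    simp [boostDeriv, boostJacobian, dotProduct, Fin.sum_univ_three]
  · refine (((hc 2).sub ((hasFDerivAt_p0 p).const_mul v)).const_mul
      (gammaFactor v)).congr_fderiv ?_
    ext x
    simp [boostDeriv, boostJacobian, dotProduct, Fin.sum_univ_three]
    ring

/-- The Jacobian is lower triangular with diagonal `1, 1, γ (1 - v p³ / p⁰)`, and the last entry is
the ratio of the new `p⁰` to the old one. This is the invariance of `d³p / p⁰`. -/
lemma abs_det_boostDeriv {v : ℝ} (hv : |v| < 1) (p : Momentum) :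
    |(boostDeriv v p).det| = p0 (boostMomentum v p) * (p0 p)⁻¹ := by
  have h : (boostDeriv v p).det = p0 (boostMomentum v p) * (p0 p)⁻¹ := by
    rw [ContinuousLinearMap.det, boostDeriv, LinearMap.coe_toContinuousLinearMap,
      LinearMap.det_toLin', boostJacobian, Matrix.det_fin_three, p0_boostMomentum hv]
    have := (p0_pos p).ne'
    simp
    field_simp
  rw [h, abs_of_pos (mul_pos (p0_pos _) (inv_pos.2 (p0_pos p)))]

lemma boostMomentum_injective {v : ℝ} (hv : |v| < 1) : Function.Injective (boostMomentum v) :=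
  Function.LeftInverse.injective (boostMomentum_neg_boostMomentum hv)

lemma range_boostMomentum {v : ℝ} (hv : |v| < 1) : Set.range (boostMomentum v) = Set.univ :=
  Function.RightInverse.surjective (boostMomentum_boostMomentum_neg hv) |>.range_eq

lemma abs_det_boostDeriv_smul {v : ℝ} (hv : |v| < 1) (h : Momentum → ℝ) (p : Momentum) :
    |(boostDeriv v p).det| • (h (boostMomentum v p) * (p0 (boostMomentum v p))⁻¹) =
      h (boostMomentum v p) * (p0 p)⁻¹ := by
  rw [abs_det_boostDeriv hv, smul_eq_mul]
  field_simp [(p0_pos (boostMomentum v p)).ne']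

/-- No regularity of `h` is required, so the identity also applies to the entries of `Dmat`, whose
integrability is never examined. -/
lemma integral_boostMomentum {v : ℝ} (hv : |v| < 1) (h : Momentum → ℝ) :
    ∫ p, h (boostMomentum v p) * (p0 p)⁻¹ = ∫ p, h p * (p0 p)⁻¹ := by
  have := integral_image_eq_integral_abs_det_fderiv_smul volume MeasurableSet.univ
    (fun p _ => (hasFDerivAt_boostMomentum v p).hasFDerivWithinAt)
    (boostMomentum_injective hv).injOn (fun p => h p * (p0 p)⁻¹)
  simp only [Set.image_univ, range_boostMomentum hv, abs_det_boostDeriv_smul hv,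
    setIntegral_univ] at this
  exact this.symm

lemma integrable_boostMomentum {v : ℝ} (hv : |v| < 1) (h : Momentum → ℝ) :
    Integrable (fun p => h (boostMomentum v p) * (p0 p)⁻¹) ↔
      Integrable (fun p => h p * (p0 p)⁻¹) := by
  have := integrableOn_image_iff_integrableOn_abs_det_fderiv_smul volume MeasurableSet.univ
    (fun p _ => (hasFDerivAt_boostMomentum v p).hasFDerivWithinAt)
    (boostMomentum_injective hv).injOn (fun p => h p * (p0 p)⁻¹)
  simp only [Set.image_univ, range_boostMomentum hv, abs_det_boostDeriv_smul hv,
    integrableOn_univ] at this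
  exact this.symm

lemma momInner_boostMomentum {u v : ℝ} (hu : |u| < 1) (hv : |v| < 1) (θ : ℝ)
    (f h : Momentum → ℝ) :
    momInner (relVelocity v u) θ f h =
      momInner u θ (fun p => f (boostMomentum v p)) (fun p => h (boostMomentum v p)) := by
  rw [momInner, ← integral_boostMomentum hv, momInner]
  simp only [juttner_boostMomentum hu hv]

/-! ### Integrability of the entries of the moment matrices -/

/-- Measurable functions of at most polynomial growth in `p⁰`. -/
def PolyGrowth (a : Momentum → ℝ) : Prop :=
  Measurable a ∧ ∃ (C : ℝ) (N : ℕ), ∀ p, |a p| ≤ C * p0 p ^ N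

lemma continuous_p0 : Continuous p0 := by
  unfold p0
  fun_prop

lemma continuous_energy (u : ℝ) : Continuous (energy u) := by
  have := continuous_p0
  unfold energy
  fun_prop

lemma continuous_axialMomentum (u : ℝ) : Continuous (axialMomentum u) := by
  have := continuous_p0
  unfold axialMomentum
  fun_prop

lemma PolyGrowth.mul {a b : Momentum → ℝ} (ha : PolyGrowth a) (hb : PolyGrowth b) :
    PolyGrowth (fun p => a p * b p) := by
  obtain ⟨ha, C, N, hC⟩ := ha
  obtain ⟨hb, C', N', hC'⟩ := hb
  refine ⟨ha.mul hb, C * C', N + N', fun p => ?_⟩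
  rw [abs_mul, pow_add, mul_mul_mul_comm]
  exact mul_le_mul (hC p) (hC' p) (abs_nonneg _) ((abs_nonneg _).trans (hC p))

lemma PolyGrowth.add {a b : Momentum → ℝ} (ha : PolyGrowth a) (hb : PolyGrowth b) :
    PolyGrowth (fun p => a p + b p) := by
  obtain ⟨ha, C, N, hC⟩ := ha
  obtain ⟨hb, C', N', hC'⟩ := hb
  refine ⟨ha.add hb, |C| + |C'|, N + N', fun p => (abs_add_le _ _).trans ?_⟩
  rw [add_mul]
  refine add_le_add ((hC p).trans ?_) ((hC' p).trans ?_)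
  · exact mul_le_mul (le_abs_self _) (pow_le_pow_right₀ (one_le_p0 p) (by omega))
      (pow_nonneg (p0_pos p).le _) (abs_nonneg _)
  · exact mul_le_mul (le_abs_self _) (pow_le_pow_right₀ (one_le_p0 p) (by omega))
      (pow_nonneg (p0_pos p).le _) (abs_nonneg _)

lemma polyGrowth_const (c : ℝ) : PolyGrowth (fun _ => c) :=
  ⟨measurable_const, |c|, 0, fun p => by simp⟩

lemma PolyGrowth.pow {a : Momentum → ℝ} (ha : PolyGrowth a) (n : ℕ) :
    PolyGrowth (fun p => a p ^ n) := by
  induction n with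
  | zero => simpa using polyGrowth_const 1
  | succ n ih => simpa only [pow_succ] using ih.mul ha

lemma PolyGrowth.eval {a : Momentum → ℝ} (ha : PolyGrowth a) (P : ℝ[X]) :
    PolyGrowth (fun p => P.eval (a p)) := by
  induction P using Polynomial.induction_on' with
  | add P Q hP hQ => simpa only [eval_add] using hP.add hQ
  | monomial n c => simpa only [eval_monomial] using (polyGrowth_const c).mul (ha.pow n)

lemma PolyGrowth.mono {a b : Momentum → ℝ} (hb : PolyGrowth b) (ha : Measurable a)
    (h : ∀ p, |a p| ≤ |b p|) : PolyGrowth a := by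
  obtain ⟨_, C, N, hC⟩ := hb
  exact ⟨ha, C, N, fun p => (h p).trans (hC p)⟩

lemma polyGrowth_p0 : PolyGrowth p0 :=
  ⟨continuous_p0.measurable, 1, 1, fun p => by simp [abs_of_pos (p0_pos p)]⟩

lemma polyGrowth_coord (i : Fin 3) : PolyGrowth (fun p => p i) :=
  polyGrowth_p0.mono (measurable_pi_apply i)
    fun p => (abs_coord_le_p0 p i).trans (le_abs_self _)

lemma polyGrowth_p0_inv : PolyGrowth (fun p => (p0 p)⁻¹) :=
  (polyGrowth_const 1).mono continuous_p0.measurable.inv fun p => by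
    rw [abs_one, abs_of_pos (inv_pos.2 (p0_pos p))]
    exact inv_le_one_of_one_le₀ (one_le_p0 p)

lemma polyGrowth_energy (u : ℝ) : PolyGrowth (energy u) := by
  have := ((polyGrowth_const (gammaFactor u)).mul polyGrowth_p0).add
    ((polyGrowth_const (-(gammaFactor u * u))).mul (polyGrowth_coord 2))
  exact this.mono (continuous_energy u).measurable fun p => le_of_eq (by rw [energy]; ring_nf)

/-- This bounds the axial momentum by `√(E² - 1)`, so that `cosAngle` takes values in `[-1, 1]`. -/
lemma energy_sq_sub_axialMomentum_sq {u : ℝ} (hu : |u| < 1) (p : Momentum) :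
    energy u p ^ 2 - axialMomentum u p ^ 2 = 1 + p 0 ^ 2 + p 1 ^ 2 := by
  rw [energy, axialMomentum]
  linear_combination (p0 p ^ 2 - p 2 ^ 2) * gammaFactor_sq_mul hu + p0_sq p

lemma abs_cosAngle_le_one {u : ℝ} (hu : |u| < 1) (p : Momentum) : |cosAngle u p| ≤ 1 := by
  rw [cosAngle, abs_div, abs_of_nonneg (Real.sqrt_nonneg _)]
  -- A vanishing denominator (`E = 1`) is harmless: the quotient is then `0` by convention.
  refine div_le_one_of_le₀ (Real.abs_le_sqrt ?_) (Real.sqrt_nonneg _)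
  nlinarith [energy_sq_sub_axialMomentum_sq hu p, sq_nonneg (p 0), sq_nonneg (p 1)]

lemma measurable_cosAngle (u : ℝ) : Measurable (cosAngle u) := by
  have h1 := (continuous_axialMomentum u).measurable
  have h2 := (continuous_energy u).measurable
  unfold cosAngle
  fun_prop

lemma polyGrowth_cosAngle {u : ℝ} (hu : |u| < 1) : PolyGrowth (cosAngle u) :=
  (polyGrowth_const 1).mono (measurable_cosAngle u) fun p => by
    simpa using abs_cosAngle_le_one hu p

lemma polyGrowth_sqrt_energy (u : ℝ) : PolyGrowth (fun p => Real.sqrt (energy u p ^ 2 - 1)) := by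
  have h := (continuous_energy u).measurable
  refine (polyGrowth_energy u).mono (by fun_prop) fun p => ?_
  rw [abs_of_nonneg (Real.sqrt_nonneg _), ← Real.sqrt_sq_eq_abs]
  exact Real.sqrt_le_sqrt (by linarith)

/-- Turns the Jüttner factor into exponential decay in `p⁰`, at a positive rate because `|u| < 1`.
-/
lemma le_energy {u : ℝ} (hu : |u| < 1) (p : Momentum) :
    gammaFactor u * (1 - |u|) * p0 p ≤ energy u p := by
  have h : u * p 2 ≤ |u| * p0 p := (le_abs_self _).trans <| by
    rw [abs_mul]
    exact mul_le_mul_of_nonneg_left (abs_coord_le_p0 p 2) (abs_nonneg u)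
  rw [energy]
  nlinarith [gammaFactor_pos hu]

lemma norm_le_p0 (p : Momentum) : ‖p‖ ≤ p0 p :=
  (pi_norm_le_iff_of_nonneg (p0_pos p).le).2 (abs_coord_le_p0 p)

lemma integrable_exp_neg_energy_mul {u θ : ℝ} (hu : |u| < 1) (hθ : 0 < θ) {a : Momentum → ℝ}
    (ha : PolyGrowth a) : Integrable (fun p => Real.exp (-energy u p / θ) * a p) := by
  obtain ⟨ha, C, N, hC⟩ := ha
  have hE := (continuous_energy u).measurable
  set c : ℝ := gammaFactor u * (1 - |u|) / θ with hc
  have hc0 : 0 < c := div_pos (mul_pos (gammaFactor_pos hu) (sub_pos.2 hu)) hθ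
  -- The exponent `4` exceeds the dimension `3`. The bound `exp (-x) ≤ n! / xⁿ` with `n = N + 4`
  -- absorbs the growth `(p⁰)^N` and leaves `(p⁰)⁻⁴`.
  have hint : Integrable (fun p : Momentum => (1 + ‖p‖) ^ (-(4 : ℝ))) :=
    integrable_one_add_norm (by simp; norm_num)
  refine (hint.const_mul (|C| * ((N + 4).factorial / c ^ (N + 4) * 2 ^ 4))).mono'
    (by fun_prop) (Filter.Eventually.of_forall fun p => ?_)
  have h1 : Real.exp (-energy u p / θ) ≤ (N + 4).factorial / (c * p0 p) ^ (N + 4) := by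
    have hx : 0 < c * p0 p := mul_pos hc0 (p0_pos p)
    have h2 := Real.pow_div_factorial_le_exp (c * p0 p) hx.le (N + 4)
    have h3 : -energy u p / θ ≤ -(c * p0 p) := by
      rw [neg_div, neg_le_neg_iff, hc, div_mul_eq_mul_div]
      exact div_le_div_of_nonneg_right (le_energy hu p) hθ.le
    refine (Real.exp_le_exp.2 h3).trans ?_
    rw [Real.exp_neg, ← inv_div]
    exact inv_anti₀ (by positivity) h2
  have h4 : (p0 p ^ 4)⁻¹ ≤ 2 ^ 4 * (1 + ‖p‖) ^ (-(4 : ℝ)) := by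
    have h5 : 1 + ‖p‖ ≤ 2 * p0 p := by linarith [norm_le_p0 p, one_le_p0 p]
    have h6 : (1 + ‖p‖) ^ 4 ≤ (2 * p0 p) ^ 4 := pow_le_pow_left₀ (by positivity) h5 4
    rw [mul_pow] at h6
    have h7 : 0 < 1 + ‖p‖ := by positivity
    have h8 := p0_pos p
    rw [Real.rpow_neg h7.le, show (4 : ℝ) = ((4 : ℕ) : ℝ) by norm_num, Real.rpow_natCast,
      ← div_eq_mul_inv, inv_le_comm₀ (by positivity) (by positivity), inv_div,
      div_le_iff₀ (by positivity)]
    linarith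
  have h8 := p0_pos p
  rw [Real.norm_eq_abs, abs_mul, abs_of_pos (Real.exp_pos _)]
  calc Real.exp (-energy u p / θ) * |a p|
      ≤ (N + 4).factorial / (c * p0 p) ^ (N + 4) * (|C| * p0 p ^ N) := by
        refine mul_le_mul h1 ((hC p).trans ?_) (abs_nonneg _) (by positivity)
        exact mul_le_mul_of_nonneg_right (le_abs_self C) (by positivity)
    _ = |C| * ((N + 4).factorial / c ^ (N + 4) * (p0 p ^ 4)⁻¹) := by
        field_simp
        ring_nf
    _ ≤ |C| * ((N + 4).factorial / c ^ (N + 4) * (2 ^ 4 * (1 + ‖p‖) ^ (-(4 : ℝ)))) := by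
        gcongr
    _ = _ := by ring

/-- The polynomial factor of `basisFun`. -/
noncomputable def basisFactor (l k : ℕ) (u θ : ℝ) (p : Momentum) : ℝ :=
  (orthoPoly l θ⁻¹ k).eval (energy u p) *
    (Real.sqrt (energy u p ^ 2 - 1) ^ l * (legendre l).eval (cosAngle u p))

lemma polyGrowth_basisFactor (l k : ℕ) {u : ℝ} (hu : |u| < 1) (θ : ℝ) :
    PolyGrowth (basisFactor l k u θ) :=
  ((polyGrowth_energy u).eval _).mul
    (((polyGrowth_sqrt_energy u).pow l).mul ((polyGrowth_cosAngle hu).eval _))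

lemma basisFun_eq (l k : ℕ) (u θ : ℝ) (p : Momentum) :
    basisFun l k u θ p = juttner u θ p * basisFactor l k u θ p := by
  rw [basisFun, basisFactor, mul_assoc]

/-- The inverse weight cancels one of the two Jüttner factors; the other dominates the remaining
factor of polynomial growth. -/
lemma integrable_mul_basisFun_mul_basisFun {u θ : ℝ} (hu : |u| < 1) (hθ : 0 < θ)
    {a : Momentum → ℝ} (ha : PolyGrowth a) (l k l' k' : ℕ) :
    Integrable (fun p => (juttner u θ p)⁻¹ * (a p * basisFun l k u θ p) *
      basisFun l' k' u θ p * (p0 p)⁻¹) := by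
  have h := (integrable_exp_neg_energy_mul hu hθ (((ha.mul (polyGrowth_basisFactor l k hu θ)).mul
    (polyGrowth_basisFactor l' k' hu θ)).mul polyGrowth_p0_inv)).const_mul
      (θ⁻¹ / (4 * Real.pi * besselK 2 θ⁻¹))
  refine h.congr (Filter.Eventually.of_forall fun p => ?_)
  simp only [basisFun_eq]
  rw [← mul_assoc, ← juttner]
  -- Splitting here avoids proving that the Bessel normalization is nonzero: if the weight vanishes,
  -- both sides are `0`.
  rcases eq_or_ne (juttner u θ p) 0 with h0 | h0
  · simp [h0]
  · field_simp

lemma multMatrix_linear {M : ℕ} {W : State M} (hW : W.Admissible) {a b : Momentum → ℝ}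
    (ha : PolyGrowth a) (hb : PolyGrowth b) (r s : ℝ) :
    multMatrix (fun p => r * (a p - s * b p)) W =
      r • (multMatrix a W - s • multMatrix b W) := by
  ext i j
  simp only [multMatrix, Matrix.of_apply, Matrix.smul_apply, Matrix.sub_apply, smul_eq_mul,
    momInner]
  rw [← integral_const_mul, ← integral_sub
    (integrable_mul_basisFun_mul_basisFun hW.2.1 hW.2.2 ha _ _ _ _)
    ((integrable_mul_basisFun_mul_basisFun hW.2.1 hW.2.2 hb _ _ _ _).const_mul s),
    ← integral_const_mul]
  congr 1
  ext p
  ring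

/-! ### Boosts of states -/

/-- The place of the velocity in a state vector. -/
def velIdx {M : ℕ} (hM : 1 ≤ M) : Idx M := ⟨⟨0, by omega⟩, ⟨1, by simp only [Nat.sub_zero]; omega⟩⟩

lemma eq_velIdx_iff {M : ℕ} (hM : 1 ≤ M) (q : Idx M) :
    q = velIdx hM ↔ (q.1 : ℕ) = 0 ∧ (q.2 : ℕ) = 1 := by
  refine ⟨fun h => by rw [h]; exact ⟨rfl, rfl⟩, fun h => ?_⟩
  obtain ⟨⟨l, hl⟩, ⟨k, hk⟩⟩ := q
  obtain ⟨rfl, rfl⟩ : l = 0 ∧ k = 1 := h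
  rfl

lemma velocity_eq {M : ℕ} (hM : 1 ≤ M) (W : State M) : W.velocity = W (velIdx hM) :=
  dif_pos ⟨by omega, by omega⟩

/-- This form lets boosts be commuted or merged with the updates that define the partial derivatives
in `Dmat`. -/
lemma boostState_eq_update {M : ℕ} (hM : 1 ≤ M) (v : ℝ) (W : State M) :
    boostState v W = Function.update W (velIdx hM) (relVelocity v W.velocity) := by
  ext q
  by_cases h : q = velIdx hM
  · rw [boostState, if_pos ((eq_velIdx_iff hM q).1 h), h, Function.update_self, relVelocity]
  · rw [boostState, if_neg (mt (eq_velIdx_iff hM q).2 h), Function.update_of_ne h]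

lemma boostState_apply_velIdx {M : ℕ} (hM : 1 ≤ M) (v : ℝ) (W : State M) :
    boostState v W (velIdx hM) = relVelocity v (W (velIdx hM)) := by
  rw [boostState_eq_update hM, Function.update_self, velocity_eq hM]

lemma boostState_apply_of_ne {M : ℕ} (hM : 1 ≤ M) (v : ℝ) (W : State M) {q : Idx M}
    (hq : q ≠ velIdx hM) : boostState v W q = W q := by
  rw [boostState_eq_update hM, Function.update_of_ne hq]

lemma velocity_boostState {M : ℕ} (hM : 1 ≤ M) (v : ℝ) (W : State M) :
    (boostState v W).velocity = relVelocity v W.velocity := by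
  rw [velocity_eq hM, boostState_apply_velIdx, velocity_eq hM]

lemma entry_boostState {M : ℕ} (v : ℝ) (W : State M) {k l : ℕ} (h : ¬ (l = 0 ∧ k = 1)) :
    (boostState v W).entry k l = W.entry k l := by
  unfold State.entry
  split_ifs with h'
  · exact if_neg h
  · rfl

@[simp] lemma density_boostState {M : ℕ} (v : ℝ) (W : State M) :
    (boostState v W).density = W.density := entry_boostState v W (by omega)

@[simp] lemma temp_boostState {M : ℕ} (v : ℝ) (W : State M) :
    (boostState v W).temp = W.temp := entry_boostState v W (by omega)

@[simp] lemma bulk_boostState {M : ℕ} (v : ℝ) (W : State M) :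
    (boostState v W).bulk = W.bulk := entry_boostState v W (by omega)

@[simp] lemma diffusion_boostState {M : ℕ} (v : ℝ) (W : State M) :
    (boostState v W).diffusion = W.diffusion := entry_boostState v W (by omega)

@[simp] lemma equilibriumCoeff_boostState {M : ℕ} (v : ℝ) (W : State M) (q : Idx M) :
    equilibriumCoeff (boostState v W) q = equilibriumCoeff W q := by
  simp [equilibriumCoeff]

-- The velocity occupies the place `(k, ℓ) = (1, 0)`, where `coeff` takes its first branch and does
-- not read `W q`; all other data are scalars.
@[simp] lemma coeff_boostState {M : ℕ} (v : ℝ) (W : State M) (q : Idx M) :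
    coeff (boostState v W) q = coeff W q := by
  unfold coeff
  split_ifs with h1 h2
  · simp
  · simp
  · exact if_neg (by omega)

lemma State.Admissible.boostState {M : ℕ} (hM : 1 ≤ M) {v : ℝ} (hv : |v| < 1) {W : State M}
    (hW : W.Admissible) : (boostState v W).Admissible := by
  refine ⟨by simpa using hW.1, ?_, by simpa using hW.2.2⟩
  rw [velocity_boostState hM]
  exact abs_relVelocity_lt_one hW.2.1 hv

lemma boostState_neg_boostState {M : ℕ} (hM : 1 ≤ M) {v : ℝ} (hv : |v| < 1) {W : State M}
    (hW : W.Admissible) : boostState (-v) (boostState v W) = W := by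
  rw [boostState_eq_update hM, velocity_boostState hM,
    relVelocity_neg_relVelocity hW.2.1 hv, boostState_eq_update hM, Function.update_idem,
    velocity_eq hM, Function.update_eq_self]

lemma projDist_boostState {M : ℕ} (hM : 1 ≤ M) {v : ℝ} (hv : |v| < 1) {W : State M}
    (hu : |W.velocity| < 1) (p : Momentum) :
    projDist (boostState v W) (boostMomentum v p) = projDist W p := by
  simp only [projDist, coeff_boostState, velocity_boostState hM, temp_boostState,
    basisFun_boostMomentum hu hv]

/-! ### Transformation of the matrices and of the source -/

lemma multMatrix_boostState {M : ℕ} (hM : 1 ≤ M) {v : ℝ} (hv : |v| < 1) (a : Momentum → ℝ)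
    {W : State M} (hu : |W.velocity| < 1) :
    multMatrix a (boostState v W) = multMatrix (fun p => a (boostMomentum v p)) W := by
  ext i j
  simp only [multMatrix, Matrix.of_apply, velocity_boostState hM, temp_boostState,
    momInner_boostMomentum hu hv, basisFun_boostMomentum hu hv]

/-- The pair `(M0, M3)` inherits the transformation law of `(p⁰, p³)`. -/
lemma M0_boostState {M : ℕ} (hM : 1 ≤ M) {v : ℝ} (hv : |v| < 1) {W : State M}
    (hW : W.Admissible) : M0 (boostState v W) = gammaFactor v • (M0 W - v • M3 W) := by
  simp only [M0, M3, multMatrix_boostState hM hv _ hW.2.1, p0_boostMomentum hv]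
  exact multMatrix_linear hW polyGrowth_p0 (polyGrowth_coord 2) _ _

lemma M3_boostState {M : ℕ} (hM : 1 ≤ M) {v : ℝ} (hv : |v| < 1) {W : State M}
    (hW : W.Admissible) : M3 (boostState v W) = gammaFactor v • (M3 W - v • M0 W) := by
  simp only [M0, M3, multMatrix_boostState hM hv _ hW.2.1, boostMomentum_two]
  exact multMatrix_linear hW (polyGrowth_coord 2) polyGrowth_p0 _ _

lemma source_boostState {M : ℕ} (hM : 1 ≤ M) (τ : ℝ → ℝ → ℝ) {v : ℝ} (hv : |v| < 1)
    {W : State M} (hu : |W.velocity| < 1) : source τ (boostState v W) = source τ W := by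
  simp only [source, multMatrix_boostState hM hv _ hu, velocity_boostState hM,
    energy_boostMomentum hu hv, density_boostState, temp_boostState, coeff_boostState,
    equilibriumCoeff_boostState]

/-- A change of variable with a local inverse transforms `deriv` by the chain rule, whether or not
the outer function is differentiable. -/
lemma deriv_comp_mul_of_local_inverse {g φ ψ : ℝ → ℝ} {x c d : ℝ} (hφ : HasDerivAt φ c x)
    (hψ : HasDerivAt ψ d (φ x)) (hx : ψ (φ x) = x) (hφψ : ∀ᶠ t in nhds (φ x), φ (ψ t) = t) :
    deriv (g ∘ φ) x = deriv g (φ x) * c := by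
  by_cases hg : DifferentiableAt ℝ g (φ x)
  · exact (hg.hasDerivAt.comp x hφ).deriv
  -- Near `φ x`, `g` equals `(g ∘ φ) ∘ ψ`, so non-differentiability passes to `g ∘ φ` and both
  -- derivatives take the default value `0`.
  · have hgφ : ¬ DifferentiableAt ℝ (g ∘ φ) x := fun h => by
      rw [← hx] at h
      refine hg ((h.comp (φ x) hψ.differentiableAt).congr_of_eventuallyEq (hφψ.mono fun t ht => ?_))
      simp only [Function.comp_apply, ht]
    rw [deriv_zero_of_not_differentiableAt hg, deriv_zero_of_not_differentiableAt hgφ, zero_mul]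

/-- The derivatives of the components of `boostState v` with respect to themselves. -/
noncomputable def boostStateFactor {M : ℕ} (hM : 1 ≤ M) (v : ℝ) (W : State M) (q : Idx M) : ℝ :=
  if q = velIdx hM then (1 - v ^ 2) / (1 - W (velIdx hM) * v) ^ 2 else 1

lemma eventually_abs_lt_one {u : ℝ} (hu : |u| < 1) : ∀ᶠ s in nhds u, |s| < 1 :=
  continuous_abs.continuousAt.eventually (gt_mem_nhds hu)

/-- Differentiates the scalar law `projDist_boostState` in one variable at fixed momentum. Only the
velocity is reparametrized, with local inverse `relVelocity (-v)`, so only that column acquires a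
chain-rule factor. -/
lemma deriv_projDist_boostState {M : ℕ} (hM : 1 ≤ M) {v : ℝ} (hv : |v| < 1) {W : State M}
    (hu : |W.velocity| < 1) (j : Idx M) (p : Momentum) :
    deriv (fun s => projDist (Function.update (boostState v W) j s) (boostMomentum v p))
        (boostState v W j) * boostStateFactor hM v W j =
      deriv (fun s => projDist (Function.update W j s) p) (W j) := by
  by_cases hj : j = velIdx hM
  · subst hj
    rw [velocity_eq hM] at hu
    have hv' : |-v| < 1 := by rwa [abs_neg]
    rw [boostStateFactor, if_pos rfl, boostState_apply_velIdx,
      ← deriv_comp_mul_of_local_inverse (hasDerivAt_relVelocity hu hv)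
        (hasDerivAt_relVelocity (abs_relVelocity_lt_one hu hv) hv')
        (relVelocity_neg_relVelocity hu hv)
        ((eventually_abs_lt_one (abs_relVelocity_lt_one hu hv)).mono fun s hs => by
          simpa using relVelocity_neg_relVelocity hs hv')]
    refine Filter.EventuallyEq.deriv_eq ((eventually_abs_lt_one hu).mono fun s hs => ?_)
    have hs' : |State.velocity (Function.update W (velIdx hM) s)| < 1 := by
      rwa [velocity_eq hM, Function.update_self]
    change projDist _ _ = projDist (Function.update W (velIdx hM) s) p
    rw [← projDist_boostState hM hv hs', boostState_eq_update hM,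
      boostState_eq_update hM, Function.update_idem, Function.update_idem,
      velocity_eq hM (Function.update _ _ _), Function.update_self]
  · rw [boostStateFactor, if_neg hj, mul_one, boostState_apply_of_ne hM v W hj]
    -- Here the two functions of `s` agree everywhere: the velocity stays fixed, and
    -- `projDist_boostState` asks nothing of the other entries, so even a negative temperature is
    -- allowed.
    congr 1
    ext s
    have hs : State.velocity (Function.update W j s) = W.velocity := by
      rw [velocity_eq hM, velocity_eq hM, Function.update_of_ne (Ne.symm hj)]
    rw [← projDist_boostState (W := Function.update W j s) hM hv (by rwa [hs]), boostState_eq_update hM,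
      boostState_eq_update hM, hs, Function.update_comm hj]

/-- The Jacobian is kept on the left because the chain rule for `boostField` produces exactly this
product. -/
lemma Dmat_boostState_mul {M : ℕ} (hM : 1 ≤ M) {v : ℝ} (hv : |v| < 1) {W : State M}
    (hu : |W.velocity| < 1) :
    Dmat (boostState v W) * Matrix.diagonal (boostStateFactor hM v W) = Dmat W := by
  ext i j
  rw [Matrix.mul_diagonal]
  simp only [Dmat, Matrix.of_apply, velocity_boostState hM, temp_boostState,
    momInner_boostMomentum hu hv, basisFun_boostMomentum hu hv,
    ← deriv_projDist_boostState hM hv hu j]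
  rw [momInner, momInner, ← integral_mul_const]
  congr 1
  ext p
  ring

/-! ### Transformation of fields -/

/-- `boostPoint v` as a continuous linear map. -/
noncomputable def boostPointL (v : ℝ) : ℝ × ℝ →L[ℝ] ℝ × ℝ :=
  (gammaFactor v • (ContinuousLinearMap.fst ℝ ℝ ℝ - v • ContinuousLinearMap.snd ℝ ℝ ℝ)).prod
    (gammaFactor v • (ContinuousLinearMap.snd ℝ ℝ ℝ - v • ContinuousLinearMap.fst ℝ ℝ ℝ))

lemma boostPointL_apply (v : ℝ) (z : ℝ × ℝ) : boostPointL v z = boostPoint v z := rfl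

lemma boostPoint_neg_boostPoint {v : ℝ} (hv : |v| < 1) (z : ℝ × ℝ) :
    boostPoint (-v) (boostPoint v z) = z := by
  ext
  · simp only [boostPoint, gammaFactor_neg]
    linear_combination z.1 * gammaFactor_sq_mul hv
  · simp only [boostPoint, gammaFactor_neg]
    linear_combination z.2 * gammaFactor_sq_mul hv

lemma hasFDerivAt_boostState {M : ℕ} (hM : 1 ≤ M) {v : ℝ} (hv : |v| < 1) {W : State M}
    (hu : |W.velocity| < 1) :
    HasFDerivAt (boostState v) (LinearMap.toContinuousLinearMap
      (Matrix.toLin' (Matrix.diagonal (boostStateFactor hM v W)))) W := by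
  rw [hasFDerivAt_pi']
  intro q
  have hc : HasFDerivAt (fun W : State M => W q)
      (ContinuousLinearMap.proj (R := ℝ) (φ := fun _ : Idx M => ℝ) q) W := hasFDerivAt_apply q W
  by_cases hq : q = velIdx hM
  · subst hq
    rw [velocity_eq hM] at hu
    simp only [boostState_apply_velIdx]
    refine ((hasDerivAt_relVelocity hu hv).comp_hasFDerivAt W hc).congr_fderiv ?_
    ext x
    simp [boostStateFactor, Matrix.mulVec_diagonal]
  · simp only [boostState_apply_of_ne hM v _ hq]
    refine hc.congr_fderiv ?_
    ext x
    simp [boostStateFactor, Matrix.mulVec_diagonal, hq]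

lemma boostField_boostPoint {M : ℕ} {v : ℝ} (hv : |v| < 1) (W : ℝ × ℝ → State M) (z : ℝ × ℝ) :
    boostField v W (boostPoint v z) = boostState v (W z) := by
  rw [boostField, boostPoint_neg_boostPoint hv]

lemma hasFDerivAt_boostField {M : ℕ} (hM : 1 ≤ M) {v : ℝ} (hv : |v| < 1)
    {W : ℝ × ℝ → State M} {z : ℝ × ℝ} (hd : DifferentiableAt ℝ W z) (hu : |(W z).velocity| < 1) :
    HasFDerivAt (boostField v W) ((LinearMap.toContinuousLinearMap
      (Matrix.toLin' (Matrix.diagonal (boostStateFactor hM v (W z))))).comp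
        ((fderiv ℝ W z).comp (boostPointL (-v)))) (boostPoint v z) := by
  have h1 : HasFDerivAt (boostPoint (-v)) (boostPointL (-v)) (boostPoint v z) :=
    (boostPointL (-v)).hasFDerivAt
  have h2 : HasFDerivAt W (fderiv ℝ W z) (boostPoint (-v) (boostPoint v z)) := by
    rw [boostPoint_neg_boostPoint hv]
    exact hd.hasFDerivAt
  have h3 := hasFDerivAt_boostState hM hv hu
  -- The base point is rewritten as the image of `boostPoint v z` so that the chain rule applies to
  -- the triple composition.
  rw [← boostPoint_neg_boostPoint hv z] at h3
  have := HasFDerivAt.comp (boostPoint v z) h3 (HasFDerivAt.comp (boostPoint v z) h2 h1)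
  rw [boostPoint_neg_boostPoint hv z] at this
  exact this

lemma transport_boostField {M : ℕ} (hM : 1 ≤ M) {v : ℝ} (hv : |v| < 1)
    {W : ℝ × ℝ → State M} {z : ℝ × ℝ} (hd : DifferentiableAt ℝ W z) (hW : (W z).Admissible) :
    transport (boostField v W) (boostPoint v z) = transport W z := by
  have e1 : boostPointL (-v) (1, 0) = gammaFactor v • ((1, 0) + v • (0, 1) : ℝ × ℝ) := by
    simp [boostPointL_apply, boostPoint, gammaFactor_neg]
  have e2 : boostPointL (-v) (0, 1) = gammaFactor v • ((0, 1) + v • (1, 0) : ℝ × ℝ) := by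
    simp [boostPointL_apply, boostPoint, gammaFactor_neg]
  have hD := Dmat_boostState_mul hM hv hW.2.1
  rw [transport, transport, (hasFDerivAt_boostField hM hv hd hW.2.1).fderiv,
    boostField_boostPoint hv]
  simp only [ContinuousLinearMap.comp_apply, LinearMap.coe_toContinuousLinearMap',
    Matrix.toLin'_apply, B0, B3, Matrix.mulVec_mulVec, Matrix.mul_assoc, hD, e1, e2]
  simp only [map_smul, map_add, M0_boostState hM hv hW, M3_boostState hM hv hW,
    ← Matrix.mulVec_mulVec, Matrix.mulVec_smul, Matrix.mulVec_add, Matrix.smul_mulVec,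
    Matrix.sub_mulVec]
  set a := (M0 (W z)).mulVec ((Dmat (W z)).mulVec (fderiv ℝ W z (1, 0)))
  set b := (M0 (W z)).mulVec ((Dmat (W z)).mulVec (fderiv ℝ W z (0, 1)))
  set c := (M3 (W z)).mulVec ((Dmat (W z)).mulVec (fderiv ℝ W z (1, 0)))
  set d := (M3 (W z)).mulVec ((Dmat (W z)).mulVec (fderiv ℝ W z (0, 1)))
  ext q
  simp only [Pi.add_apply, Pi.smul_apply, Pi.sub_apply, smul_eq_mul]
  -- The cross terms `± v b` and `± v c` cancel, leaving `γ² (1 - v²) (a + d)`.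
  linear_combination (a q + d q) * gammaFactor_sq_mul hv

/-- Applies the forward direction to the inverse boost. Boosting back recovers `W` at admissible
values, so admissibility is required on a neighbourhood; this is where openness of `Ω` enters. -/
lemma differentiableAt_of_boostField {M : ℕ} (hM : 1 ≤ M) {v : ℝ} (hv : |v| < 1)
    {W : ℝ × ℝ → State M} {z : ℝ × ℝ} (hW : ∀ᶠ y in nhds z, (W y).Admissible)
    (hd : DifferentiableAt ℝ (boostField v W) (boostPoint v z)) : DifferentiableAt ℝ W z := by
  have hv' : |-v| < 1 := by rwa [abs_neg]
  have hz : (boostField v W (boostPoint v z)).Admissible := by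
    rw [boostField_boostPoint hv]
    exact hW.self_of_nhds.boostState hM hv
  have h := (hasFDerivAt_boostField hM hv' hd hz.2.1).differentiableAt
  rw [boostPoint_neg_boostPoint hv] at h
  refine h.congr_of_eventuallyEq (hW.mono fun y hy => ?_)
  rw [boostField, neg_neg, boostField_boostPoint hv, boostState_neg_boostState hM hv hy]

lemma isSolution_boostField_iff {M : ℕ} (hM : 1 ≤ M) (τ : ℝ → ℝ → ℝ) {v : ℝ} (hv : |v| < 1)
    {Ω : Set (ℝ × ℝ)} {W : ℝ × ℝ → State M} (hΩ : IsOpen Ω) (hW : ∀ z ∈ Ω, (W z).Admissible) :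
    IsSolution τ Ω W ↔ IsSolution τ (boostPoint v '' Ω) (boostField v W) := by
  rw [IsSolution, IsSolution, Set.forall_mem_image]
  refine forall₂_congr fun z hz => ?_
  have hd : DifferentiableAt ℝ W z ↔
      DifferentiableAt ℝ (boostField v W) (boostPoint v z) :=
    ⟨fun h => (hasFDerivAt_boostField hM hv h (hW z hz).2.1).differentiableAt,
      differentiableAt_of_boostField hM hv (Filter.mem_of_superset (hΩ.mem_nhds hz) hW)⟩
  have ha : (boostState v (W z)).Admissible := (hW z hz).boostState hM hv
  rw [boostField_boostPoint hv, source_boostState hM τ hv (hW z hz).2.1, ← hd]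
  simp only [hW z hz, ha, true_and]
  exact and_congr_right fun h => by rw [transport_boostField hM hv h (hW z hz)]

/-! ### Transformation of distributions -/

lemma momInner_comp_boostMomentum_neg {u v : ℝ} (hu : |u| < 1) (hv : |v| < 1) (θ : ℝ)
    (f h : Momentum → ℝ) :
    momInner (relVelocity v u) θ (fun p => f (boostMomentum (-v) p)) h =
      momInner u θ f (fun p => h (boostMomentum v p)) := by
  simp only [momInner_boostMomentum hu hv, boostMomentum_neg_boostMomentum hv]

lemma integral_mul_comp_boostMomentum_neg {v : ℝ} (hv : |v| < 1) (a f : Momentum → ℝ) :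
    ∫ p, a p * f (boostMomentum (-v) p) * (p0 p)⁻¹ =
      ∫ p, a (boostMomentum v p) * f p * (p0 p)⁻¹ := by
  rw [← integral_boostMomentum hv]
  simp only [boostMomentum_neg_boostMomentum hv]

lemma boostMomentum_update {v : ℝ} (p : Momentum) {i : Fin 3} (hi : i ≠ 2) :
    boostMomentum v (Function.update p i (-p i)) =
      Function.update (boostMomentum v p) i (-boostMomentum v p i) := by
  have h0 : p0 (Function.update p i (-p i)) = p0 p := by
    unfold p0
    fin_cases i <;> simp_all
  ext j
  fin_cases i <;> fin_cases j <;> simp_all [boostMomentum]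

lemma integrable_pow_mul_comp_boostMomentum_neg {v : ℝ} (hv : |v| < 1) {f : Momentum → ℝ} {N : ℕ}
    (h : Integrable (fun p : Momentum => p0 p ^ N * f p * (p0 p)⁻¹)) :
    Integrable (fun p : Momentum => p0 p ^ N * f (boostMomentum (-v) p) * (p0 p)⁻¹) := by
  rw [← integrable_boostMomentum hv (fun p => p0 p ^ N * f (boostMomentum (-v) p))]
  simp only [boostMomentum_neg_boostMomentum hv, p0_boostMomentum hv]
  have hc := continuous_p0
  have hr : Continuous fun p : Momentum => (gammaFactor v * (p0 p - v * p 2) / p0 p) ^ N := by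
    have h0 (p : Momentum) : p0 p ≠ 0 := (p0_pos p).ne'
    fun_prop (disch := assumption)
  -- The change of variables replaces `(p⁰)^N` by its boosted value; the ratio of the two is
  -- continuous and at most `(2γ)^N`, since `-v p³ < p⁰`.
  refine (h.bdd_mul (c := (gammaFactor v * 2) ^ N) hr.aestronglyMeasurable
    (Filter.Eventually.of_forall fun p => ?_)).congr (Filter.Eventually.of_forall fun p => ?_)
  · have hp := p0_pos p
    have hg := gammaFactor_pos hv
    have hlt := mul_coord_lt_p0 hv p
    have hlt' := mul_coord_lt_p0 (v := -v) (by rwa [abs_neg]) p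
    rw [norm_pow, Real.norm_eq_abs,
      abs_of_nonneg (div_nonneg (mul_nonneg hg.le (by linarith)) hp.le)]
    refine pow_le_pow_left₀ (div_nonneg (mul_nonneg hg.le (by linarith)) hp.le) ?_ N
    rw [div_le_iff₀ hp, mul_assoc]
    exact mul_le_mul_of_nonneg_left (by linarith) hg.le
  · have hp := (p0_pos p).ne'
    simp only [div_pow]
    field_simp

/-- Every defining moment pairs `f` with a function of the scalars `E` and axial momentum, so it is
unchanged under the invariant measure. The symmetries survive because `p⁰` is even in `p¹` and `p²`.
-/
lemma IsStateOf.boost {M : ℕ} (hM : 1 ≤ M) {v : ℝ} (hv : |v| < 1) {f : Momentum → ℝ}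
    {W : State M} (hu : |W.velocity| < 1) (h : IsStateOf f W) :
    IsStateOf (fun p => f (boostMomentum (-v) p)) (boostState v W) where
  symm_one p := by rw [boostMomentum_update p (by decide), h.symm_one]
  symm_two p := by rw [boostMomentum_update p (by decide), h.symm_two]
  integrable N hN := integrable_pow_mul_comp_boostMomentum_neg hv (h.integrable N hN)
  density := by
    rw [integral_mul_comp_boostMomentum_neg hv]
    simp only [velocity_boostState hM, energy_boostMomentum hu hv, density_boostState, h.density]
  landau := by
    rw [integral_mul_comp_boostMomentum_neg hv fun p => QuasiOneD.energy _ p * axialMomentum _ p]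
    simp only [velocity_boostState hM, energy_boostMomentum hu hv,
      axialMomentum_boostMomentum hu hv, h.landau]
  energy := by
    rw [integral_mul_comp_boostMomentum_neg hv fun p => QuasiOneD.energy _ p ^ 2]
    simp only [velocity_boostState hM, energy_boostMomentum hu hv, density_boostState,
      temp_boostState, h.energy]
  bulk hM2 := by
    rw [integral_mul_comp_boostMomentum_neg hv fun p => QuasiOneD.energy _ p ^ 2 - 1]
    simp only [velocity_boostState hM, energy_boostMomentum hu hv, density_boostState,
      temp_boostState, bulk_boostState, h.bulk hM2]
  diffusion hM2 := by
    rw [integral_mul_comp_boostMomentum_neg hv]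
    simp only [velocity_boostState hM, axialMomentum_boostMomentum hu hv, diffusion_boostState,
      h.diffusion hM2]
  coeff q h0 h1 := by
    have hq : q ≠ velIdx hM := by
      rw [Ne, eq_velIdx_iff]
      omega
    rw [boostState_apply_of_ne hM v W hq, velocity_boostState hM, temp_boostState,
      momInner_comp_boostMomentum_neg hu hv]
    simp only [basisFun_boostMomentum hu hv]
    exact h.coeff q h0 h1

end QuasiOneD

theorem mainTheorem4 (M : ℕ) (hM : 1 ≤ M) (τ : ℝ → ℝ → ℝ)
    (hτ : ∀ n θ : ℝ, 0 < n → 0 < θ → 0 < τ n θ) (v : ℝ) (hv : |v| < 1) :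
    -- transformation law of the dependent variables, for a scalar distribution function
    (∀ (f : QuasiOneD.Momentum → ℝ) (W : QuasiOneD.State M), W.Admissible →
      QuasiOneD.IsStateOf f W →
        (QuasiOneD.boostState v W).Admissible ∧
        QuasiOneD.IsStateOf (fun p' => f (QuasiOneD.boostMomentum (-v) p'))
          (QuasiOneD.boostState v W)) ∧
    -- invariance of the left-hand side of the system
    (∀ (W : ℝ × ℝ → QuasiOneD.State M) (z : ℝ × ℝ), DifferentiableAt ℝ W z → (W z).Admissible →
      DifferentiableAt ℝ (QuasiOneD.boostField v W) (QuasiOneD.boostPoint v z) ∧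
      QuasiOneD.transport (QuasiOneD.boostField v W) (QuasiOneD.boostPoint v z) =
        QuasiOneD.transport W z) ∧
    -- invariance of the source term
    (∀ W : QuasiOneD.State M, W.Admissible →
      QuasiOneD.source τ (QuasiOneD.boostState v W) = QuasiOneD.source τ W) ∧
    -- the system has the same solutions in both frames
    (∀ (Ω : Set (ℝ × ℝ)) (W : ℝ × ℝ → QuasiOneD.State M), IsOpen Ω →
      (∀ z ∈ Ω, (W z).Admissible) →
        (QuasiOneD.IsSolution τ Ω W ↔
          QuasiOneD.IsSolution τ (QuasiOneD.boostPoint v '' Ω) (QuasiOneD.boostField v W))) :=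
  ⟨fun _ _ hW h => ⟨hW.boostState hM hv, h.boost hM hv hW.2.1⟩,
    fun _ _ hd hW => ⟨(QuasiOneD.hasFDerivAt_boostField hM hv hd hW.2.1).differentiableAt,
      QuasiOneD.transport_boostField hM hv hd hW⟩,
    fun _ hW => QuasiOneD.source_boostState hM τ hv hW.2.1,
    fun _ _ hΩ hW => QuasiOneD.isSolution_boostField_iff hM τ hv hΩ hW⟩
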